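/- Fix an integer $k \ge 1$. For $n \ge 2$ put $P = n^2$ and let $G$ be the $\sqrt P \times \sqrt P$ square grid graph with node set $V$, $|V| = P$ (nodes are joined to their nearest horizontal and vertical neighbours). Let $G_{\mathrm{sw}}(k)$ be the random undirected graph obtained from $G$ by adding, for every node $v \in V$, $k$ long-range edges $\{v, w_{v,1}\}, \dots, \{v, w_{v,k}\}$, where all the endpoints $w_{v,j}$ are independent and $w_{v,j}$ is uniformly distributed on $V \setminus \{v\}$ (repeated edges are merged). Let $u, v$ be independent and uniformly distributed on $V$, independent of the long-range edges. Then, as $P \to \infty$ along the perfect squares, \[ \mathbb{E}\bigl[d_{G_{\mathrm{sw}}(k)}(u,v)\bigr] = O(\log P), \] where $d$ denotes shortest-path distance, the expectation is over both the long-range edges and $u, v$, and the implied constant may depend on $k$. For the grid itself, in contrast, $\mathbb{E}\bigl[d_G(u,v)\bigr] = \Theta(\sqrt P)$. -/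

import Mathlib

open Filter Asymptotics
open scoped BigOperators

/-- The `P = n ^ 2` nodes of the `n × n` square grid. -/
abbrev GridNode (n : ℕ) : Type := Fin n × Fin n

/-- The `n × n` square grid graph: two nodes are adjacent iff they agree in one coordinate and
differ by exactly one in the other. -/
def gridGraph (n : ℕ) : SimpleGraph (GridNode n) :=
  (SimpleGraph.pathGraph n).boxProd (SimpleGraph.pathGraph n)

/-- The sample space of the shortcuts: every node `v` chooses `k` endpoints in `V \ {v}`.
The uniform distribution on this finite product is the law of `k` independent uniform choices in
`V \ {v}` at every node `v`, independently over the nodes. -/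
abbrev Shortcuts (n k : ℕ) : Type :=
  (v : GridNode n) → Fin k → {w : GridNode n // w ≠ v}

/-- The (undirected) graph of the long-range edges `{v, ω v j}`. -/
def shortcutGraph {n k : ℕ} (ω : Shortcuts n k) : SimpleGraph (GridNode n) :=
  SimpleGraph.fromRel fun v w => ∃ j : Fin k, (ω v j : GridNode n) = w

/-- The small-world graph: the grid together with the long-range edges. -/
def smallWorldGraph {n k : ℕ} (ω : Shortcuts n k) : SimpleGraph (GridNode n) :=
  gridGraph n ⊔ shortcutGraph ω

/-- The characteristic path length: the mean of the graph distance between two nodes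
sampled independently and uniformly. -/
noncomputable def avgDist {V : Type*} [Fintype V] (G : SimpleGraph V) : ℝ :=
  𝔼 p : V × V, (G.dist p.1 p.2 : ℝ)

/-- The expected distance, over the random shortcuts and two uniformly sampled nodes. -/
noncomputable def smallWorldMeanDist (n k : ℕ) : ℝ :=
  𝔼 ω : Shortcuts n k, avgDist (smallWorldGraph ω)

/-! Cut each row of the grid into segments ("blocks") of between 80 and 159 nodes. With probability
at least `1 - 1/B`, where `B` is the number of blocks, every set of at most `B/2` blocks grows by a
factor `3/2` when the blocks hit by its shortcuts are added (`card_not_isExpanding_le`). This is a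
union bound over pairs `S ⊆ T` with `|T| < 3|S|/2`: all shortcuts leaving `S` must land in `T`, and
a block holds enough nodes for this probability to beat the number of pairs.

Under expansion, the neighbourhoods of two blocks each exceed half of all blocks after `O(log B)`
steps, hence meet; a step costs one shortcut and a walk inside a block, so all distances are `O(log
P)` (`IsExpanding.dist_le`). Otherwise the grid bound `2n` applies, with probability at most `1/B ≤
1/n`, which adds at most 2 to the mean.

For the grid alone, distances are at most `2n`, and a cyclic shift by `n/2` gives a lower bound of
order `n`. -/

/-! ### Probability estimate for one pair, and the numerical union bound. -/

section Counting

variable {V : Type*} [Fintype V] [DecidableEq V]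

/-- The shortcuts all of whose edges starting in `S` end in `T`, with `S ⊆ T`, form a proportion
of at most `(|T| / |V|) ^ |S|`. -/
theorem card_shortcuts_into_le {k : ℕ} (hk : 1 ≤ k) {S T : Finset V} (hST : S ⊆ T) :
    (((Finset.univ : Finset ((v : V) → Fin k → {w : V // w ≠ v})).filter
      fun ω => ∀ v ∈ S, ∀ j, (ω v j : V) ∈ T).card : ℝ) ≤
    ((T.card : ℝ) / Fintype.card V) ^ S.card *
      Fintype.card ((v : V) → Fin k → {w : V // w ≠ v}) := by
  have hset : ((Finset.univ : Finset ((v : V) → Fin k → {w : V // w ≠ v})).filter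
      fun ω => ∀ v ∈ S, ∀ j, (ω v j : V) ∈ T) =
      Fintype.piFinset fun v => if v ∈ S then
        (Fintype.piFinset fun _ : Fin k => Finset.univ.filter fun w : {w : V // w ≠ v} =>
          (w : V) ∈ T : Finset (Fin k → {w : V // w ≠ v}))
        else Finset.univ := by
    ext ω
    simp only [Finset.mem_filter, Finset.mem_univ, true_and, Fintype.mem_piFinset]
    refine forall_congr' fun v => ?_
    by_cases hv : v ∈ S <;> simp [hv]
  -- The power becomes a product over all nodes with factor 1 off `S`, so the bound can be checked
  -- node by node.
  rw [hset, Fintype.card_piFinset, Fintype.card_pi, ← Finset.prod_const,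
    ← Finset.prod_subset (Finset.subset_univ S) (f := fun v => if v ∈ S then
      (T.card : ℝ) / Fintype.card V else 1) (by intro x _ hx; simp [hx]) |>.symm.trans
      (Finset.prod_congr rfl fun x hx => by simp [hx])]
  push_cast
  rw [← Finset.prod_mul_distrib]
  refine Finset.prod_le_prod (fun _ _ => by positivity) fun v _ => ?_
  by_cases hv : v ∈ S
  · simp only [hv, if_true]
    rw [Fintype.card_piFinset_const, Fintype.card_fun, Fintype.card_fin]
    have h1 : (Finset.univ.filter fun w : {w : V // w ≠ v} => (w : V) ∈ T).card =
        T.card - 1 := by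
      rw [← Finset.card_erase_of_mem (hST hv)]
      refine Finset.card_bij (fun w _ => (w : V)) ?_ ?_ ?_
      · intro w hw
        simp only [Finset.mem_filter, Finset.mem_univ, true_and] at hw
        exact Finset.mem_erase.2 ⟨w.2, hw⟩
      · intro a _ b _ h
        exact Subtype.ext h
      · intro w hw
        obtain ⟨h1, h2⟩ := Finset.mem_erase.1 hw
        exact ⟨⟨w, h1⟩, by simpa using h2, rfl⟩
    have h2 : Fintype.card {w : V // w ≠ v} = Fintype.card V - 1 := by
      simp [Fintype.card_subtype_compl]
    have hT1 : 1 ≤ T.card := Finset.card_pos.2 ⟨v, hST hv⟩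
    have hTV : T.card ≤ Fintype.card V := Finset.card_le_univ T
    rw [h1, h2]
    push_cast [Nat.cast_sub hT1, Nat.cast_sub (hT1.trans hTV)]
    have hT1' : (1 : ℝ) ≤ T.card := by exact_mod_cast hT1
    have hTV' : (T.card : ℝ) ≤ Fintype.card V := by exact_mod_cast hTV
    generalize (T.card : ℝ) = t at *
    generalize (Fintype.card V : ℝ) = N at *
    have hN : 0 < N := by linarith
    have hp0 : 0 ≤ t / N := by positivity
    have hp1 : t / N ≤ 1 := (div_le_one hN).2 hTV'
    -- As `v ∈ T` is itself excluded as an endpoint, the exact probability is `(t-1)/(N-1) ≤ t/N`.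
    have hle : t - 1 ≤ t / N * (N - 1) := by
      have : t / N * N = t := by field_simp
      nlinarith
    calc (t - 1) ^ k ≤ (t / N * (N - 1)) ^ k := pow_le_pow_left₀ (by linarith) hle k
      _ = (t / N) ^ k * (N - 1) ^ k := mul_pow _ _ _
      _ ≤ t / N * (N - 1) ^ k := by
        refine mul_le_mul_of_nonneg_right ?_ (pow_nonneg (by linarith) _)
        exact pow_le_of_le_one hp0 hp1 (by omega)
  · simp [hv]

/-- A union bound: the sum over pairs `S ⊆ T ≠ ∅` of subsets of a `B`-element set. -/
theorem sum_choose_mul_le {B : ℕ} (hB : 0 < B) {q : ℕ → ℝ}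
    (hq : ∀ t, 1 ≤ t → t ≤ B → 0 ≤ q t ∧ q t ≤ ((t : ℝ) / B) ^ 2 / 24) :
    ∑ t ∈ Finset.Icc 1 B, (B.choose t : ℝ) * 2 ^ t * q t ^ t ≤ 1 / B := by
  have hB' : (0 : ℝ) < B := by exact_mod_cast hB
  have key : ∀ t ∈ Finset.Icc 1 B,
      (B.choose t : ℝ) * 2 ^ t * q t ^ t ≤ (1 / B) * (1 / 2) ^ t := by
    intro t ht
    obtain ⟨h1, h2⟩ := Finset.mem_Icc.1 ht
    obtain ⟨hq0, hq1⟩ := hq t h1 h2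
    have ht0 : (0 : ℝ) < t := by exact_mod_cast h1
    set r : ℝ := (t : ℝ) / B with hr
    have hr0 : 0 < r := by positivity
    have hr1 : r ≤ 1 := (div_le_one hB').2 (by exact_mod_cast h2)
    -- From `t^t / t! ≤ e^t ≤ 3^t`.
    have hc : (B.choose t : ℝ) ≤ (3 / r) ^ t := by
      have hf : ((t : ℝ) ^ t) / (t.factorial : ℝ) ≤ 3 ^ t := by
        refine (Real.pow_div_factorial_le_exp _ ht0.le t).trans ?_
        rw [← Real.exp_one_pow]
        exact pow_le_pow_left₀ (Real.exp_pos _).le (by linarith [Real.exp_one_lt_d9]) _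
      calc (B.choose t : ℝ) ≤ (B : ℝ) ^ t / (t.factorial : ℝ) := Nat.choose_le_pow_div t B
        _ = (t : ℝ) ^ t / (t.factorial : ℝ) * (1 / r) ^ t := by
          rw [hr, one_div_div, div_pow]; field_simp
        _ ≤ 3 ^ t * (1 / r) ^ t := by gcongr
        _ = (3 / r) ^ t := by rw [← mul_pow]; ring
    calc (B.choose t : ℝ) * 2 ^ t * q t ^ t
        ≤ (3 / r) ^ t * 2 ^ t * (r ^ 2 / 24) ^ t := by gcongr
      _ = r ^ t * (1 / 4) ^ t := by
        rw [← mul_pow, ← mul_pow, ← mul_pow]; congr 1; field_simp; norm_num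
      -- Keeping one factor `r = t / B` yields the `1 / B` of the conclusion.
      _ ≤ r * (1 / 4) ^ t := by
        gcongr
        exact pow_le_of_le_one hr0.le hr1 (by omega)
      _ = (1 / B) * (t * (1 / 4) ^ t) := by rw [hr]; ring
      _ ≤ (1 / B) * (1 / 2) ^ t := by
        gcongr
        have h2t : (t : ℝ) ≤ 2 ^ t := by exact_mod_cast Nat.lt_two_pow_self.le
        calc (t : ℝ) * (1 / 4) ^ t ≤ 2 ^ t * (1 / 4) ^ t := by gcongr
          _ = (1 / 2) ^ t := by rw [← mul_pow]; norm_num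
  refine (Finset.sum_le_sum key).trans ?_
  rw [← Finset.mul_sum]
  refine mul_le_of_le_one_right (by positivity) ?_
  have : ∀ b : ℕ, ∑ t ∈ Finset.Icc 1 b, ((1 : ℝ) / 2) ^ t = 1 - (1 / 2) ^ b := by
    intro b
    induction b with
    | zero => simp
    | succ b ih => rw [Finset.sum_Icc_succ_top (by omega), ih, pow_succ]; ring
  rw [this]
  linarith [pow_pos (show (0 : ℝ) < 1 / 2 by norm_num) B]

end Counting

/-! ### From sets of blocks to sets of nodes. -/

theorem card_blocks_eq_sum {V W : Type*} [Fintype V] [DecidableEq W]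
    (b : V → W) (S : Finset W) :
    (Finset.univ.filter fun v => b v ∈ S).card =
      ∑ w ∈ S, (Finset.univ.filter fun v => b v = w).card := by
  rw [Finset.card_eq_sum_card_fiberwise (f := b) (t := S) (by intro v hv; simpa using hv)]
  refine Finset.sum_congr rfl fun w hw => ?_
  congr 1
  ext v
  simp only [Finset.mem_filter, Finset.mem_univ, true_and, and_iff_right_iff_imp]
  rintro rfl
  exact hw

theorem mul_card_le_card_blocks {V W : Type*} [Fintype V] [DecidableEq W]
    {b : V → W} {m : ℕ}
    (h : ∀ w, m ≤ (Finset.univ.filter fun v => b v = w).card) (S : Finset W) :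
    m * S.card ≤ (Finset.univ.filter fun v => b v ∈ S).card := by
  rw [card_blocks_eq_sum, mul_comm, ← smul_eq_mul]
  exact Finset.card_nsmul_le_sum _ _ _ fun w _ => h w

theorem card_blocks_le_mul_card {V W : Type*} [Fintype V] [DecidableEq W]
    {b : V → W} {m : ℕ}
    (h : ∀ w, (Finset.univ.filter fun v => b v = w).card ≤ m) (S : Finset W) :
    (Finset.univ.filter fun v => b v ∈ S).card ≤ m * S.card := by
  rw [card_blocks_eq_sum, mul_comm, ← smul_eq_mul]
  exact Finset.sum_le_card_nsmul _ _ _ fun w _ => h w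

/-! ### Expansion of the random shortcuts on blocks. -/

section Blocks

variable {V W : Type*} [Fintype V] [Fintype W] [DecidableEq W]

/-- The blocks in `S` together with the blocks reached from `S` by one shortcut. -/
def shortcutStep {k : ℕ} (b : V → W) (ω : (v : V) → Fin k → {w : V // w ≠ v})
    (S : Finset W) : Finset W :=
  S ∪ Finset.univ.filter fun w => ∃ v j, b v ∈ S ∧ b (ω v j) = w

/-- Every set of at most half of the blocks grows by half under `shortcutStep`. -/
def IsExpanding {k : ℕ} (b : V → W) (ω : (v : V) → Fin k → {w : V // w ≠ v}) : Prop :=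
  ∀ S : Finset W, S.Nonempty → 2 * S.card ≤ Fintype.card W →
    3 * S.card ≤ 2 * (shortcutStep b ω S).card

/-- The proportion of nodes in a set of at most three quarters of the blocks. -/
theorem card_blocks_div_card_le [Nonempty W] {b : V → W} {m : ℕ} (hm : 0 < m)
    (h₁ : ∀ w, m ≤ (Finset.univ.filter fun v => b v = w).card)
    (h₂ : ∀ w, (Finset.univ.filter fun v => b v = w).card ≤ 2 * m)
    {T : Finset W} (hT : 4 * T.card < 3 * Fintype.card W) :
    ((Finset.univ.filter fun v => b v ∈ T).card : ℝ) / Fintype.card V ≤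
      min (2 * ((T.card : ℝ) / Fintype.card W)) (7 / 8) := by
  have hB : 0 < Fintype.card W := Fintype.card_pos
  have lowV := mul_card_le_card_blocks h₁ Finset.univ
  have uppV := card_blocks_le_mul_card h₂ Finset.univ
  simp only [Finset.mem_univ, Finset.filter_true, Finset.card_univ] at lowV uppV
  have uppT := card_blocks_le_mul_card h₂ T
  have lowC := mul_card_le_card_blocks h₁ Tᶜ
  have hsum : (Finset.univ.filter fun v => b v ∈ T).card +
      (Finset.univ.filter fun v => b v ∈ Tᶜ).card = Fintype.card V := by
    simp only [Finset.mem_compl]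
    rw [Finset.card_filter_add_card_filter_not, Finset.card_univ]
  have hTc : Tᶜ.card + T.card = Fintype.card W := by
    rw [add_comm]; exact Finset.card_add_card_compl T
  generalize (Finset.univ.filter fun v => b v ∈ T).card = x at *
  generalize (Finset.univ.filter fun v => b v ∈ Tᶜ).card = y at *
  generalize T.card = t at *
  generalize Tᶜ.card = c at *
  generalize Fintype.card W = B at *
  generalize Fintype.card V = N at *
  have hN : 0 < N := lt_of_lt_of_le (Nat.mul_pos hm hB) lowV
  have hN' : (0 : ℝ) < N := by exact_mod_cast hN
  have hB' : (0 : ℝ) < B := by exact_mod_cast hB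
  refine le_min ?_ ?_
  · rw [div_le_iff₀ hN']
    have e1 : (x : ℝ) ≤ 2 * m * t := by exact_mod_cast uppT
    have e2 : (m : ℝ) * B ≤ N := by exact_mod_cast lowV
    calc (x : ℝ) ≤ 2 * m * t := e1
      _ = 2 * ((t : ℝ) / B) * (m * B) := by field_simp
      _ ≤ _ := by gcongr
  · rw [div_le_iff₀ hN']
    -- Here `x ≤ 2mt`, `y ≥ mc` and `t < 3c`, so `x ≤ 6y` and `x ≤ 6N/7`.
    have : 8 * x ≤ 7 * N := by nlinarith
    have : (8 : ℝ) * x ≤ 7 * N := by exact_mod_cast this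
    linarith

/-- All but a proportion `1 / |W|` of the shortcuts are expanding. -/
theorem card_not_isExpanding_le [DecidableEq V] [Nonempty W] {k m : ℕ} (hk : 1 ≤ k) (hm : 80 ≤ m) {b : V → W}
    (h₁ : ∀ w, m ≤ (Finset.univ.filter fun v => b v = w).card)
    (h₂ : ∀ w, (Finset.univ.filter fun v => b v = w).card ≤ 2 * m)
    [DecidablePred fun ω : (v : V) → Fin k → {w : V // w ≠ v} => ¬ IsExpanding b ω] :
    ((Finset.univ.filter
      fun ω : (v : V) → Fin k → {w : V // w ≠ v} => ¬ IsExpanding b ω).card : ℝ) ≤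
    1 / Fintype.card W * Fintype.card ((v : V) → Fin k → {w : V // w ≠ v}) := by
  classical
  set Ω := (v : V) → Fin k → {w : V // w ≠ v}
  set B := Fintype.card W with hBdef
  have hB : 0 < B := Fintype.card_pos
  have hB' : (0 : ℝ) < B := by exact_mod_cast hB
  let F : Finset W → Finset W → Finset Ω := fun S T => Finset.univ.filter fun ω =>
    ∀ v ∈ Finset.univ.filter (fun v => b v ∈ S), ∀ j,
      (ω v j : V) ∈ Finset.univ.filter (fun v => b v ∈ T)
  let I : Finset (Finset W) := (Finset.univ : Finset W).powerset.filter fun T =>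
    1 ≤ T.card ∧ 4 * T.card < 3 * B
  let J : Finset W → Finset (Finset W) := fun T => T.powerset.filter fun S =>
    2 * T.card < 3 * S.card
  let q : ℕ → ℝ := fun t => (min (2 * ((t : ℝ) / B)) (7 / 8)) ^ 40
  have hq0 : ∀ t, 0 ≤ q t := fun t => by positivity
  -- If `S` fails to expand, take `T = shortcutStep b ω S`; `|S| ≤ B/2` forces `|T| < 3B/4`.
  have hsub : (Finset.univ.filter fun ω : Ω => ¬ IsExpanding b ω) ⊆
      I.biUnion fun T => (J T).biUnion fun S => F S T := by
    intro ω hω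
    simp only [Finset.mem_filter, Finset.mem_univ, true_and, IsExpanding, not_forall,
      not_le] at hω
    obtain ⟨S, hne, hS, hlt⟩ := hω
    have hST : S ⊆ shortcutStep b ω S := Finset.subset_union_left
    have hc := Finset.card_le_card hST
    have hpos := hne.card_pos
    simp only [Finset.mem_biUnion, I, J, F, Finset.mem_filter, Finset.mem_powerset,
      Finset.subset_univ, Finset.mem_univ, true_and]
    refine ⟨shortcutStep b ω S, ⟨by omega, by omega⟩, S, ⟨hST, hlt⟩, fun v hv j => ?_⟩
    refine Finset.mem_union_right _ ?_
    simp only [Finset.mem_filter, Finset.mem_univ, true_and]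
    exact ⟨v, j, hv, rfl⟩
  have hF : ∀ T ∈ I, ∀ S ∈ J T, ((F S T).card : ℝ) ≤ q T.card ^ T.card * Fintype.card Ω := by
    intro T hT S hS
    simp only [I, Finset.mem_filter] at hT
    simp only [J, Finset.mem_filter, Finset.mem_powerset] at hS
    have hsub' : (Finset.univ.filter fun v => b v ∈ S) ⊆
        Finset.univ.filter fun v => b v ∈ T := by
      intro v hv
      simp only [Finset.mem_filter, Finset.mem_univ, true_and] at hv ⊢
      exact hS.1 hv
    refine (card_shortcuts_into_le hk hsub').trans ?_
    refine mul_le_mul_of_nonneg_right ?_ (Nat.cast_nonneg _)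
    have hp := card_blocks_div_card_le (by omega : 0 < m) h₁ h₂ hT.2.2
    have hs := mul_card_le_card_blocks h₁ S
    -- `80|S| > 80 · (2/3)|T|`, which leaves room above 40.
    have hexp : 40 * T.card ≤ (Finset.univ.filter fun v => b v ∈ S).card := by nlinarith
    simp only [q]
    rw [← pow_mul]
    refine (pow_le_pow_left₀ (by positivity) hp _).trans ?_
    refine pow_le_pow_of_le_one (by positivity) ?_ hexp
    exact (min_le_right _ _).trans (by norm_num)
  have hcard : ((Finset.univ.filter fun ω : Ω => ¬ IsExpanding b ω).card : ℝ) ≤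
      ∑ T ∈ I, ∑ S ∈ J T, ((F S T).card : ℝ) := by
    have := (Finset.card_le_card hsub).trans (Finset.card_biUnion_le.trans
      (Finset.sum_le_sum fun T _ => Finset.card_biUnion_le))
    exact_mod_cast this
  -- `2 ^ t` counts the `S ⊆ T`; the value 0 at `t = 0` removes the empty set once the sum runs over
  -- all `T`.
  let g : ℕ → ℝ := fun t => if t = 0 then 0 else 2 ^ t * q t ^ t
  have hg0 : ∀ t, 0 ≤ g t := fun t => by
    have := hq0 t
    simp only [g]; split_ifs <;> positivity
  calc _ ≤ ∑ T ∈ I, ∑ S ∈ J T, ((F S T).card : ℝ) := hcard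
    _ ≤ ∑ T ∈ I, g T.card * Fintype.card Ω := by
      refine Finset.sum_le_sum fun T hT => ?_
      have hT1 : T.card ≠ 0 := by
        simp only [I, Finset.mem_filter] at hT
        omega
      refine (Finset.sum_le_card_nsmul _ _ _ (hF T hT)).trans ?_
      have hJ : ((J T).card : ℝ) ≤ 2 ^ T.card := by
        have := (Finset.card_filter_le T.powerset fun S => 2 * T.card < 3 * S.card)
        rw [Finset.card_powerset] at this
        exact_mod_cast this
      have := hq0 T.card
      simp only [g, hT1, if_false, nsmul_eq_mul, mul_assoc]
      gcongr
    _ ≤ ∑ T ∈ (Finset.univ : Finset W).powerset, g T.card * Fintype.card Ω :=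
      Finset.sum_le_sum_of_subset_of_nonneg (Finset.filter_subset _ _) fun T _ _ =>
        mul_nonneg (hg0 _) (Nat.cast_nonneg _)
    _ = (∑ t ∈ Finset.Icc 1 B, (B.choose t : ℝ) * 2 ^ t * q t ^ t) * Fintype.card Ω := by
      rw [← Finset.sum_mul, Finset.sum_powerset_apply_card g, Finset.card_univ, ← hBdef]
      congr 1
      rw [Finset.range_eq_Ico, Finset.sum_eq_sum_Ico_succ_bot (Nat.succ_pos B)]
      simp only [g, if_true, smul_zero, zero_add]
      refine Finset.sum_congr rfl fun t ht => ?_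
      have : t ≠ 0 := by have := Finset.mem_Ico.1 ht; omega
      simp only [this, if_false, nsmul_eq_mul, mul_assoc]
    _ ≤ _ := by
      refine mul_le_mul_of_nonneg_right (sum_choose_mul_le hB fun t ht _ => ⟨hq0 t, ?_⟩)
        (Nat.cast_nonneg _)
      simp only [q]
      set r : ℝ := (t : ℝ) / B
      have hr : 0 ≤ r := by positivity
      calc (min (2 * r) (7 / 8)) ^ 40 = (min (2 * r) (7 / 8)) ^ 2 * (min (2 * r) (7 / 8)) ^ 38 := by
            rw [← pow_add]
        _ ≤ (2 * r) ^ 2 * (7 / 8) ^ 38 := by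
          gcongr
          · exact min_le_left _ _
          · exact min_le_right _ _
        _ = r ^ 2 * (4 * (7 / 8) ^ 38) := by ring
        _ ≤ r ^ 2 * (1 / 24) := by gcongr; norm_num
        _ = r ^ 2 / 24 := by ring

end Blocks

/-! ### From expansion to logarithmic distances. -/

section Reach

variable {V W : Type*} [Fintype V] [Fintype W] [DecidableEq W]

/-- Each step uses one shortcut and then a walk of length at most `D` inside the block it enters. -/
theorem dist_le_of_mem_iterate_shortcutStep {k D : ℕ} {b : V → W}
    {ω : (v : V) → Fin k → {w : V // w ≠ v}} {H : SimpleGraph V} (hH : H.Connected)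
    (hω : ∀ v j, H.Adj v (ω v j)) (hD : ∀ v v', b v = b v' → H.dist v v' ≤ D) (u : V) (i : ℕ) :
    ∀ v, b v ∈ (shortcutStep b ω)^[i] {b u} → H.dist u v ≤ D + i * (D + 1) := by
  induction i with
  | zero =>
    intro v hv
    simpa using hD u v (by simpa [eq_comm] using hv)
  | succ i ih =>
    intro v hv
    rw [Function.iterate_succ_apply', shortcutStep, Finset.mem_union] at hv
    rcases hv with hv | hv
    · exact (ih v hv).trans (by nlinarith)
    · simp only [Finset.mem_filter, Finset.mem_univ, true_and] at hv
      obtain ⟨x, j, hx, hxv⟩ := hv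
      have h1 := ih x hx
      have h2 := SimpleGraph.dist_eq_one_iff_adj.2 (hω x j)
      have h3 := hD _ _ hxv
      have h4 := hH.dist_triangle (u := u) (v := x) (w := v)
      have h5 := hH.dist_triangle (u := x) (v := ω x j) (w := v)
      nlinarith

theorem IsExpanding.lt_two_mul_card_iterate {k i : ℕ} {b : V → W}
    {ω : (v : V) → Fin k → {w : V // w ≠ v}} (h : IsExpanding b ω)
    (hi : 2 ^ i * Fintype.card W < 3 ^ i) (w : W) :
    Fintype.card W < 2 * ((shortcutStep b ω)^[i] {w}).card := by
  -- Either half is already exceeded, which persists, or growth by `3/2` has held at every step so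
  -- far.
  have key : ∀ i, Fintype.card W < 2 * ((shortcutStep b ω)^[i] {w}).card ∨
      3 ^ i ≤ 2 ^ i * ((shortcutStep b ω)^[i] {w}).card := by
    intro i
    induction i with
    | zero => right; simp
    | succ i ih =>
      rw [Function.iterate_succ_apply']
      set S := (shortcutStep b ω)^[i] {w}
      have hle : S.card ≤ (shortcutStep b ω S).card :=
        Finset.card_le_card Finset.subset_union_left
      rcases lt_or_ge (Fintype.card W) (2 * S.card) with hlt | hge
      · left; omega
      · have h3 := ih.resolve_left (by omega)
        have hne : S.Nonempty := by
          rw [← Finset.card_pos]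
          by_contra h0
          have : 0 < 3 ^ i := by positivity
          rw [Nat.eq_zero_of_not_pos h0] at h3
          omega
        right
        have := h S hne hge
        calc 3 ^ (i + 1) = 3 ^ i * 3 := pow_succ _ _
          _ ≤ 2 ^ i * S.card * 3 := by gcongr
          _ = 2 ^ i * (3 * S.card) := by ring
          _ ≤ 2 ^ i * (2 * (shortcutStep b ω S).card) := by gcongr
          _ = 2 ^ (i + 1) * (shortcutStep b ω S).card := by ring
  refine (key i).resolve_right fun h3 => ?_
  have : 2 ^ i * ((shortcutStep b ω)^[i] {w}).card ≤ 2 ^ i * Fintype.card W :=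
    Nat.mul_le_mul_left _ (Finset.card_le_univ _)
  omega

/-- With `L = Nat.log 2 B + 1`: `4^L · B < 8^L ≤ 9^L`. -/
theorem two_pow_mul_lt_three_pow (B : ℕ) :
    2 ^ (2 * (Nat.log 2 B + 1)) * B < 3 ^ (2 * (Nat.log 2 B + 1)) := by
  have h : B < 2 ^ (Nat.log 2 B + 1) := Nat.lt_pow_succ_log_self (by norm_num) B
  rw [pow_mul, pow_mul]
  calc (2 ^ 2) ^ (Nat.log 2 B + 1) * B
      < (2 ^ 2) ^ (Nat.log 2 B + 1) * 2 ^ (Nat.log 2 B + 1) := by gcongr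
    _ = 8 ^ (Nat.log 2 B + 1) := by rw [← mul_pow]; norm_num
    _ ≤ (3 ^ 2) ^ (Nat.log 2 B + 1) := Nat.pow_le_pow_left (by norm_num) _

/-- Expanding shortcuts make all distances logarithmic in the number of blocks. -/
theorem IsExpanding.dist_le {k D : ℕ} {b : V → W} (hb : Function.Surjective b)
    {ω : (v : V) → Fin k → {w : V // w ≠ v}} (h : IsExpanding b ω)
    {H : SimpleGraph V} (hH : H.Connected)
    (hω : ∀ v j, H.Adj v (ω v j)) (hD : ∀ v v', b v = b v' → H.dist v v' ≤ D) (u v : V) :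
    H.dist u v ≤ 2 * (D + 2 * (Nat.log 2 (Fintype.card W) + 1) * (D + 1)) := by
  set i := 2 * (Nat.log 2 (Fintype.card W) + 1) with hi
  have hpow : 2 ^ i * Fintype.card W < 3 ^ i := two_pow_mul_lt_three_pow _
  have hu := h.lt_two_mul_card_iterate hpow (b u)
  have hv := h.lt_two_mul_card_iterate hpow (b v)
  have hmeet : ∃ w, w ∈ (shortcutStep b ω)^[i] {b u} ∧ w ∈ (shortcutStep b ω)^[i] {b v} := by
    by_contra hne
    push Not at hne
    have hdis := Finset.disjoint_left.2 hne
    have := Finset.card_le_univ ((shortcutStep b ω)^[i] {b u} ∪ (shortcutStep b ω)^[i] {b v})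
    rw [Finset.card_union_of_disjoint hdis] at this
    omega
  obtain ⟨w, hwu, hwv⟩ := hmeet
  obtain ⟨x, rfl⟩ := hb w
  have h1 := dist_le_of_mem_iterate_shortcutStep hH hω hD u i x hwu
  have h2 := dist_le_of_mem_iterate_shortcutStep hH hω hD v i x hwv
  have h3 := hH.dist_triangle (u := u) (v := x) (w := v)
  rw [SimpleGraph.dist_comm (u := x)] at h3
  omega

end Reach

/-! ### Distances in the grid, and its division into blocks. -/

section Grid

theorem pathGraph_dist_le {n : ℕ} (d : ℕ) :
    ∀ i j : Fin n, i.val + d = j.val → (SimpleGraph.pathGraph n).dist i j ≤ d := by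
  induction d with
  | zero =>
    intro i j h
    obtain rfl : i = j := Fin.ext (by omega)
    simp
  | succ d ih =>
    intro i j h
    have : Nonempty (Fin n) := ⟨i⟩
    have hc : (SimpleGraph.pathGraph n).Connected := ⟨SimpleGraph.pathGraph_preconnected n⟩
    let l : Fin n := ⟨i.val + d, by omega⟩
    have h1 := ih i l rfl
    have h2 : (SimpleGraph.pathGraph n).dist l j = 1 :=
      SimpleGraph.dist_eq_one_iff_adj.2 (SimpleGraph.pathGraph_adj.2 (Or.inl (by simp [l]; omega)))
    have h3 := hc.dist_triangle (u := i) (v := l) (w := j)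
    omega

theorem pathGraph_dist {n : ℕ} (i j : Fin n) :
    (SimpleGraph.pathGraph n).dist i j = Nat.dist i j := by
  apply le_antisymm
  · rcases le_total i.val j.val with h | h
    · exact pathGraph_dist_le _ i j (by simp only [Nat.dist]; omega)
    · rw [SimpleGraph.dist_comm]
      exact pathGraph_dist_le _ j i (by simp only [Nat.dist]; omega)
  · obtain ⟨p, hp⟩ :=
      (SimpleGraph.pathGraph_preconnected n i j).exists_walk_length_eq_dist
    rw [← hp]
    clear hp
    -- Each edge of a walk changes the position by one.
    induction p with
    | nil => simp
    | cons h p ih =>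
      rw [SimpleGraph.pathGraph_adj] at h
      simp only [Nat.dist, SimpleGraph.Walk.length_cons] at ih ⊢
      omega

theorem gridGraph_connected {n : ℕ} (hn : 0 < n) : (gridGraph n).Connected := by
  have : Nonempty (Fin n) := ⟨⟨0, hn⟩⟩
  have hc : (SimpleGraph.pathGraph n).Connected := ⟨SimpleGraph.pathGraph_preconnected n⟩
  exact hc.boxProd hc

theorem gridGraph_dist {n : ℕ} (x y : GridNode n) :
    (gridGraph n).dist x y = Nat.dist x.1 y.1 + Nat.dist x.2 y.2 := by
  rw [← pathGraph_dist, ← pathGraph_dist, SimpleGraph.dist, gridGraph,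
    SimpleGraph.edist_boxProd, ENat.toNat_add]
  · rfl
  · exact SimpleGraph.edist_ne_top_iff_reachable.2 (SimpleGraph.pathGraph_preconnected n _ _)
  · exact SimpleGraph.edist_ne_top_iff_reachable.2 (SimpleGraph.pathGraph_preconnected n _ _)

theorem gridGraph_dist_le {n : ℕ} (x y : GridNode n) : (gridGraph n).dist x y ≤ 2 * n := by
  rw [gridGraph_dist]
  have := x.1.2; have := x.2.2; have := y.1.2; have := y.2.2
  simp only [Nat.dist]
  omega

theorem smallWorldGraph_dist_le {n k : ℕ} (ω : Shortcuts n k) (x y : GridNode n) :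
    (smallWorldGraph ω).dist x y ≤ (gridGraph n).dist x y :=
  SimpleGraph.Reachable.dist_anti le_sup_left
    (gridGraph_connected (Nat.zero_lt_of_lt x.1.2) x y)

theorem smallWorldGraph_adj {n k : ℕ} (ω : Shortcuts n k) (v : GridNode n) (j : Fin k) :
    (smallWorldGraph ω).Adj v (ω v j) := by
  refine Or.inr ?_
  rw [shortcutGraph, SimpleGraph.fromRel_adj]
  exact ⟨(ω v j).2.symm, Or.inl ⟨j, rfl⟩⟩

/-- The grid cut into horizontal segments of `m` nodes, the last one of a row being longer if `m`
does not divide `n`. -/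
def gridBlock {n m : ℕ} (h : 0 < n / m) (v : GridNode n) : Fin n × Fin (n / m) :=
  (v.1, ⟨min (v.2 / m) (n / m - 1), by omega⟩)

theorem gridBlock_eq_iff {n m : ℕ} (hm : 0 < m) (h : 0 < n / m) (v : GridNode n)
    (w : Fin n × Fin (n / m)) :
    gridBlock h v = w ↔ v.1 = w.1 ∧ m * w.2 ≤ v.2 ∧ (v.2 < m * w.2 + m ∨ w.2 + 1 = n / m) := by
  obtain ⟨i, j⟩ := v
  obtain ⟨i', s⟩ := w
  simp only [gridBlock, Prod.mk.injEq, Fin.ext_iff]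
  refine and_congr_right fun _ => ?_
  have hs := s.2
  have e1 : ∀ a : ℕ, a ≤ j / m ↔ m * a ≤ j := fun a => by
    rw [Nat.le_div_iff_mul_le hm, mul_comm]
  have e2 := e1 s
  have e3 := e1 (s + 1)
  rw [mul_add, mul_one] at e3
  omega

theorem le_card_gridBlock {n m : ℕ} (hm : 0 < m) (h : 0 < n / m) (w : Fin n × Fin (n / m)) :
    m ≤ (Finset.univ.filter fun v : GridNode n => gridBlock h v = w).card := by
  have hw : m * (w.2 + 1) ≤ n :=
    (Nat.mul_le_mul_left m w.2.2).trans (Nat.mul_div_le n m)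
  rw [mul_add, mul_one] at hw
  let f : Fin m → GridNode n := fun a => (w.1, ⟨m * w.2 + a, by omega⟩)
  have hf : Function.Injective f := fun a a' haa => by
    simp only [f, Prod.mk.injEq, Fin.mk.injEq, true_and] at haa
    exact Fin.ext (by omega)
  calc m = ((Finset.univ : Finset (Fin m)).image f).card := by
        rw [Finset.card_image_of_injective _ hf, Finset.card_univ, Fintype.card_fin]
    _ ≤ _ := by
      refine Finset.card_le_card fun v hv => ?_
      obtain ⟨a, _, rfl⟩ := Finset.mem_image.1 hv
      simp only [Finset.mem_filter, Finset.mem_univ, true_and]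
      rw [gridBlock_eq_iff hm]
      simp [f]

theorem gridBlock_lt {n m : ℕ} (hm : 0 < m) (h : 0 < n / m) {v : GridNode n}
    {w : Fin n × Fin (n / m)} (hv : gridBlock h v = w) :
    m * w.2 ≤ v.2 ∧ (v.2 : ℕ) < m * w.2 + 2 * m := by
  obtain ⟨_, h2, h3⟩ := (gridBlock_eq_iff hm h v w).1 hv
  refine ⟨h2, ?_⟩
  rcases h3 with h3 | h3
  · omega
  · have := Nat.lt_mul_div_succ n hm
    rw [← h3] at this
    have := v.2.2
    nlinarith

theorem card_gridBlock_le {n m : ℕ} (hm : 0 < m) (h : 0 < n / m) (w : Fin n × Fin (n / m)) :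
    (Finset.univ.filter fun v : GridNode n => gridBlock h v = w).card ≤ 2 * m := by
  calc _ ≤ (Finset.Ico (m * w.2 : ℕ) (m * w.2 + 2 * m)).card := by
        refine Finset.card_le_card_of_injOn (fun v => (v.2 : ℕ)) ?_ ?_
        · intro v hv
          simp only [Finset.coe_filter, Finset.mem_univ, true_and, Set.mem_ofPred_eq] at hv
          have := gridBlock_lt hm h hv
          simpa using this
        · intro v hv v' hv' hvv
          simp only [Finset.coe_filter, Finset.mem_univ, true_and, Set.mem_ofPred_eq] at hv hv'
          have h1 := ((gridBlock_eq_iff hm h v w).1 hv).1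
          have h2 := ((gridBlock_eq_iff hm h v' w).1 hv').1
          exact Prod.ext (h1.trans h2.symm) (Fin.ext hvv)
    _ = 2 * m := by simp

theorem gridGraph_dist_le_of_gridBlock_eq {n m : ℕ} (hm : 0 < m) (h : 0 < n / m)
    {v v' : GridNode n} (hv : gridBlock h v = gridBlock h v') :
    (gridGraph n).dist v v' ≤ 2 * m := by
  rw [gridGraph_dist]
  have h1 := gridBlock_lt hm h hv
  have h2 := gridBlock_lt hm h (rfl : gridBlock h v' = _)
  have h3 := ((gridBlock_eq_iff hm h v _).1 hv).1
  have h4 : v.1 = v'.1 := h3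
  rw [h4]
  simp only [Nat.dist]
  omega

theorem gridBlock_surjective {n m : ℕ} (hm : 0 < m) (h : 0 < n / m) :
    Function.Surjective (gridBlock h : GridNode n → _) := fun w => by
  obtain ⟨v, hv⟩ := Finset.card_pos.1 (hm.trans_le (le_card_gridBlock hm h w))
  exact ⟨v, (Finset.mem_filter.1 hv).2⟩

end Grid

/-! ### Averaging over nodes and shortcuts. -/

section Averages

theorem avgDist_nonneg {V : Type*} [Fintype V] (G : SimpleGraph V) : 0 ≤ avgDist G :=
  Finset.expect_nonneg fun _ _ => Nat.cast_nonneg _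

theorem avgDist_le {V : Type*} [Fintype V] [Nonempty V] {G : SimpleGraph V} {c : ℝ}
    (h : ∀ u v, (G.dist u v : ℝ) ≤ c) : avgDist G ≤ c :=
  Finset.expect_le Finset.univ_nonempty fun p _ => h p.1 p.2

/-- Addition is modulo `n`, so `y` and its shift are `n / 2` or `n - n / 2` apart; then the triangle
inequality. -/
theorem div_two_le_dist_add_half {n : ℕ} [NeZero n] (x y : Fin n) :
    n / 2 ≤ Nat.dist x y + Nat.dist x (y + Fin.ofNat n (n / 2) : Fin n) := by
  have hn := NeZero.pos n
  have hlt : n / 2 < n := by omega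
  have hy := y.2
  rw [Fin.val_add, Fin.val_ofNat, Nat.mod_eq_of_lt hlt]
  simp only [Nat.dist]
  rcases lt_or_ge (y.val + n / 2) n with h | h
  · rw [Nat.mod_eq_of_lt h]; omega
  · rw [Nat.mod_eq_sub_mod h, Nat.mod_eq_of_lt (by omega)]; omega

theorem div_eight_le_avgDist_gridGraph {n : ℕ} (hn : 2 ≤ n) :
    (n : ℝ) / 8 ≤ avgDist (gridGraph n) := by
  have : NeZero n := ⟨by omega⟩
  -- Shifting the second node's first coordinate preserves the uniform law, so both distances have
  -- the same mean.
  let e : GridNode n × GridNode n ≃ GridNode n × GridNode n :=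
    (Equiv.refl _).prodCongr ((Equiv.addRight (Fin.ofNat n (n / 2))).prodCongr (Equiv.refl _))
  have he : avgDist (gridGraph n) =
      𝔼 p : GridNode n × GridNode n, ((gridGraph n).dist (e p).1 (e p).2 : ℝ) :=
    (Fintype.expect_equiv e _ _ fun _ => rfl).symm
  have hsum : ((n / 2 : ℕ) : ℝ) ≤ avgDist (gridGraph n) + avgDist (gridGraph n) := by
    nth_rewrite 2 [he]
    rw [avgDist, ← Finset.expect_add_distrib]
    refine Finset.le_expect Finset.univ_nonempty fun p _ => ?_
    have := div_two_le_dist_add_half p.1.1 p.2.1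
    rw [gridGraph_dist, gridGraph_dist]
    norm_cast
    refine this.trans ?_
    change _ ≤ _ + (Nat.dist p.1.1 (p.2.1 + Fin.ofNat n (n / 2) : Fin n) + _)
    omega
  have h4 : (n : ℝ) ≤ 4 * ((n / 2 : ℕ) : ℝ) := by
    exact_mod_cast (by omega : n ≤ 4 * (n / 2))
  linarith

/-- A random variable bounded by `c`, and by `a` outside of an event of probability at most `ε`,
has mean at most `a + c * ε`. -/
theorem expect_le_add_of_card_le {Ω : Type*} [Fintype Ω] [Nonempty Ω] {p : Ω → Prop}
    [DecidablePred p] {f : Ω → ℝ} {a c ε : ℝ} (ha : 0 ≤ a) (hc : 0 ≤ c)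
    (hp : ((Finset.univ.filter fun ω => ¬ p ω).card : ℝ) ≤ ε * Fintype.card Ω)
    (hfa : ∀ ω, p ω → f ω ≤ a) (hfc : ∀ ω, f ω ≤ c) : 𝔼 ω, f ω ≤ a + c * ε := by
  have hΩ : (0 : ℝ) < Fintype.card Ω := by exact_mod_cast Fintype.card_pos
  rw [Fintype.expect_eq_sum_div_card, div_le_iff₀ hΩ]
  calc ∑ ω, f ω ≤ ∑ ω, (a + if ¬ p ω then c else 0) := by
        refine Finset.sum_le_sum fun ω _ => ?_
        by_cases h : p ω
        · simpa [h] using hfa ω h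
        · simpa [h] using (hfc ω).trans (by linarith)
    _ = Fintype.card Ω * a + c * (Finset.univ.filter fun ω => ¬ p ω).card := by
        rw [Finset.sum_add_distrib, ← Finset.sum_filter]
        simp [mul_comm]
    _ ≤ Fintype.card Ω * a + c * (ε * Fintype.card Ω) := by gcongr
    _ = (a + c * ε) * Fintype.card Ω := by ring

theorem smallWorldMeanDist_nonneg (n k : ℕ) : 0 ≤ smallWorldMeanDist n k :=
  Finset.expect_nonneg fun _ _ => avgDist_nonneg _

theorem smallWorldMeanDist_le {n k : ℕ} (hk : 1 ≤ k) (hn : 80 ≤ n) :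
    smallWorldMeanDist n k ≤ 966 + 644 * (Nat.log 2 (n ^ 2) : ℝ) := by
  classical
  have hdiv : 0 < n / 80 := Nat.div_pos hn (by norm_num)
  have : Nonempty (Fin n) := ⟨⟨0, by omega⟩⟩
  have : Nonempty (Fin (n / 80)) := ⟨⟨0, hdiv⟩⟩
  have : Nontrivial (GridNode n) :=
    ⟨⟨(⟨0, by omega⟩, ⟨0, by omega⟩), (⟨1, by omega⟩, ⟨0, by omega⟩), by simp⟩⟩
  have : ∀ v : GridNode n, Nonempty {w : GridNode n // w ≠ v} := fun v =>
    let ⟨w, hw⟩ := exists_ne v; ⟨⟨w, hw⟩⟩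
  have hbad := card_not_isExpanding_le hk le_rfl (le_card_gridBlock (by norm_num) hdiv)
    (card_gridBlock_le (by norm_num) hdiv) (k := k)
  set B := Fintype.card (Fin n × Fin (n / 80)) with hB
  have hBeq : B = n * (n / 80) := by simp [hB]
  have hnB : n ≤ B := hBeq ▸ Nat.le_mul_of_pos_right n hdiv
  have hBn : B ≤ n ^ 2 := by
    rw [hBeq, sq]; exact Nat.mul_le_mul_left _ (Nat.div_le_self _ _)
  have hlog : Nat.log 2 B ≤ Nat.log 2 (n ^ 2) := Nat.log_mono_right hBn
  have hdist : ∀ ω : Shortcuts n k, ∀ u v, ((smallWorldGraph ω).dist u v : ℝ) ≤ 2 * n := by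
    intro ω u v
    exact_mod_cast (smallWorldGraph_dist_le ω u v).trans (gridGraph_dist_le u v)
  have hmain : smallWorldMeanDist n k ≤
      (964 + 644 * (Nat.log 2 (n ^ 2) : ℝ)) + 2 * n * (1 / B) := by
    refine expect_le_add_of_card_le (by positivity) (by positivity) hbad (fun ω hω => ?_)
      fun ω => avgDist_le (hdist ω)
    refine avgDist_le fun u v => ?_
    have := hω.dist_le (gridBlock_surjective (by norm_num) hdiv) (H := smallWorldGraph ω)
      (D := 2 * 80)
      ((gridGraph_connected (by omega)).mono le_sup_left) (smallWorldGraph_adj ω)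
      (fun v v' hv => (smallWorldGraph_dist_le ω v v').trans
        (gridGraph_dist_le_of_gridBlock_eq (by norm_num) hdiv hv)) u v
    rw [← hB] at this
    -- `2(160 + 2(L + 1) · 161) = 964 + 644 L`.
    have h2 : (smallWorldGraph ω).dist u v ≤ 964 + 644 * Nat.log 2 (n ^ 2) := by omega
    exact_mod_cast h2
  have hn0 : (0 : ℝ) < n := by exact_mod_cast (by omega : 0 < n)
  have hB0 : (n : ℝ) ≤ B := by exact_mod_cast hnB
  have : 2 * (n : ℝ) * (1 / B) ≤ 2 := by
    rw [mul_one_div, div_le_iff₀ (by linarith)]; linarith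
  linarith

end Averages

theorem proposition5 (k : ℕ) (hk : 1 ≤ k) :
    ((fun n : ℕ => smallWorldMeanDist n k) =O[atTop]
      fun n : ℕ => Real.log ((n ^ 2 : ℕ) : ℝ)) ∧
    ((fun n : ℕ => avgDist (gridGraph n)) =Θ[atTop]
      fun n : ℕ => Real.sqrt ((n ^ 2 : ℕ) : ℝ)) := by
  have hsqrt : ∀ n : ℕ, Real.sqrt ((n ^ 2 : ℕ) : ℝ) = n := fun n => by
    rw [Nat.cast_pow, Real.sqrt_sq (Nat.cast_nonneg n)]
  -- `2254 = 966 + 2 · 644`, from `1 ≤ log P` and `1 / log 2 ≤ 2`.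
  refine ⟨IsBigO.of_bound 2254 ?_, IsBigO.of_bound 2 ?_, IsBigO.of_bound 8 ?_⟩
  · filter_upwards [eventually_ge_atTop 80] with n hn
    have hn' : (80 : ℝ) ≤ n := by exact_mod_cast hn
    have hlog2 := Real.log_two_gt_d9
    have hX1 : 1 ≤ Real.log ((n ^ 2 : ℕ) : ℝ) := by
      calc (1 : ℝ) ≤ Real.log (2 ^ 2) := by rw [Real.log_pow]; push_cast; linarith
        _ ≤ _ := Real.log_le_log (by norm_num) (by push_cast; gcongr; linarith)
    have hX2 : (Nat.log 2 (n ^ 2) : ℝ) ≤ 2 * Real.log ((n ^ 2 : ℕ) : ℝ) := by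
      refine (Real.natLog_le_logb _ _).trans ?_
      rw [Real.logb, Nat.cast_ofNat, div_le_iff₀ (by linarith)]
      nlinarith
    rw [Real.norm_of_nonneg (smallWorldMeanDist_nonneg n k), Real.norm_of_nonneg (by linarith)]
    have := smallWorldMeanDist_le hk hn
    linarith
  · filter_upwards [eventually_ge_atTop 1] with n hn
    have : Nonempty (Fin n) := ⟨⟨0, hn⟩⟩
    rw [hsqrt, Real.norm_of_nonneg (avgDist_nonneg _), Real.norm_of_nonneg (Nat.cast_nonneg n)]
    exact avgDist_le fun u v => by exact_mod_cast gridGraph_dist_le u v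
  · filter_upwards [eventually_ge_atTop 2] with n hn
    rw [hsqrt, Real.norm_of_nonneg (avgDist_nonneg _), Real.norm_of_nonneg (Nat.cast_nonneg n)]
    linarith [div_eight_le_avgDist_gridGraph hn]
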